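/- Notation. Let $n\ge 0$ and let $\mathcal{RH}_\infty$ be the set of proper real-rational functions of $s$ without poles in the closed right half-plane $\{\mathrm{Re}\,s\ge 0\}$. For $G\in\mathcal{RH}_\infty^{n\times n}$ and $\omega\in[-\infty,\infty]$, $G(j\omega)$ is its frequency response, with $G(\pm j\infty)=\lim_{|s|\to\infty}G(s)$. For $A\in\mathbb{C}^{n\times n}$, $\bar\sigma(A)$ is the largest singular value. $A$ is called sectorial if $x^*Ax\neq 0$ for every unit vector $x\in\mathbb{C}^n$. A sectorial $A$ can be written as $A=T^*DT$ with $T$ nonsingular and $D=\mathrm{diag}(e^{j\phi_1},\dots,e^{j\phi_n})$, where $\bar\phi(A)=\phi_1\ge\dots\ge\phi_n=\underline\phi(A)$, $\bar\phi(A)-\underline\phi(A)<\pi$ and $(\bar\phi(A)+\underline\phi(A))/2\in(-\pi,\pi]$; these conditions determine $\phi_1,\dots,\phi_n$, the phases of $A$. Its phase sector is $\Psi(A)=[\underline\phi(A),\bar\phi(A)]$. The Davis-Wielandt shell of $A$ is $$\mathcal{DW}(A)=\{(\mathrm{Re}\,x^*Ax,\ \mathrm{Im}\,x^*Ax,\ \|Ax\|^2):\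 x\in\mathbb{C}^n,\ \|x\|=1\},$$ and for $\theta\in[0,\pi)$ the constrained gain of $A$ is $$\gamma_\theta(A)=\sup\{h\ge 0:\ \exists z\in\mathbb{C},\ \angle z\notin(-\theta,\theta),\ (\mathrm{Re}\,z,\mathrm{Im}\,z,h^2)\in\mathcal{DW}(A)\},$$ where $\angle z\in(-\pi,\pi]$ is the phase of $z$, $\angle 0=0$, and $\sup\emptyset=0$. (For $n=0$ put $\bar\sigma(A)=0$ and $\Psi(A)=\{0\}$.) For real-rational $n\times n$ transfer matrices $P,C$, the feedback system $P\,\#\,C$ is stable if $I+CP$ is invertible (over the field of rational functions) and $$\begin{bmatrix}I\\P\end{bmatrix}(I+CP)^{-1}\begin{bmatrix}I&C\end{bmatrix}\in\mathcal{RH}_\infty^{2n\times 2n}.$$ Theorem. Let $P,C\in\mathcal{RH}_\infty^{n\times n}$, and let $C(j\omega)$ be sectorial for all $\omega\in[-\infty,\infty]$. Suppose that for every $\omega\in[0,\infty]$ there is a $\theta=\theta(\omega)\in[0,\pi)$ such that $$\gamma_\theta(P(j\omega))\,\bar\sigma(C(j\omega))<1\quad\text{and}\quad\Psi(C(j\omega))\subset(-\pi+\theta,\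 \pi-\theta).$$ Then $P\,\#\,C$ is stable. -/

import Mathlib

open scoped Matrix

noncomputable section

namespace MixedGainPhase

/-! ### Gains, phases and the Davis-Wielandt shell of a complex matrix -/

/-- The vector `A x`, for `x` in `ℂⁿ` with the Euclidean norm. -/
def mulVecE {n : ℕ} (A : Matrix (Fin n) (Fin n) ℂ) (x : EuclideanSpace ℂ (Fin n)) :
    EuclideanSpace ℂ (Fin n) :=
  Matrix.toEuclideanCLM (n := Fin n) (𝕜 := ℂ) A x

/-- The largest singular value of `A`, that is, its spectral norm. -/
def sigmaMax {n : ℕ} (A : Matrix (Fin n) (Fin n) ℂ) : ℝ :=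
  ‖Matrix.toEuclideanCLM (n := Fin n) (𝕜 := ℂ) A‖

/-- The numerical range `{x* A x : ‖x‖ = 1}`. -/
def numRange {n : ℕ} (A : Matrix (Fin n) (Fin n) ℂ) : Set ℂ :=
  {z | ∃ x : EuclideanSpace ℂ (Fin n), ‖x‖ = 1 ∧ z = inner ℂ x (mulVecE A x)}

/-- A matrix is sectorial if its numerical range does not contain `0`. -/
def IsSectorial {n : ℕ} (A : Matrix (Fin n) (Fin n) ℂ) : Prop :=
  (0 : ℂ) ∉ numRange A

/-- `φ` lists the phases of `A`: there is a sectorial decomposition `A = T* D T` with `T`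
nonsingular and `D = diag (e^{iφ₁}, …, e^{iφₙ})`, where `φ` is listed in decreasing order, has
spread less than `π`, and its centre (the mean of the largest and the smallest phase) lies in
`(-π, π]`. -/
structure IsPhaseVector {n : ℕ} (A : Matrix (Fin n) (Fin n) ℂ) (φ : Fin n → ℝ) : Prop where
  antitone : Antitone φ
  decomposition : ∃ T : Matrix (Fin n) (Fin n) ℂ, IsUnit T.det ∧
    A = Tᴴ * Matrix.diagonal (fun k => Complex.exp ((φ k : ℂ) * Complex.I)) * T
  spread : (⨆ k, φ k) - (⨅ k, φ k) < Real.pi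
  center : ((⨆ k, φ k) + (⨅ k, φ k)) / 2 ∈ Set.Ioc (-Real.pi) Real.pi

open Classical in
/-- The phases of a sectorial matrix. A sectorial matrix has exactly one phase vector; for a matrix
without any phase vector the value is a mere default. -/
def phases {n : ℕ} (A : Matrix (Fin n) (Fin n) ℂ) : Fin n → ℝ :=
  if h : ∃ φ : Fin n → ℝ, IsPhaseVector A φ then h.choose else fun _ => Real.pi

/-- The largest phase of `A`. -/
def upperPhase {n : ℕ} (A : Matrix (Fin n) (Fin n) ℂ) : ℝ := ⨆ k, phases A k

/-- The smallest phase of `A`. -/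
def lowerPhase {n : ℕ} (A : Matrix (Fin n) (Fin n) ℂ) : ℝ := ⨅ k, phases A k

/-- The phase sector `Ψ(A)`, from the smallest to the largest phase. -/
def phaseSector {n : ℕ} (A : Matrix (Fin n) (Fin n) ℂ) : Set ℝ :=
  Set.Icc (lowerPhase A) (upperPhase A)

/-- The Davis-Wielandt shell `{(Re x*Ax, Im x*Ax, ‖Ax‖²) : ‖x‖ = 1}`. -/
def DWShell {n : ℕ} (A : Matrix (Fin n) (Fin n) ℂ) : Set (ℝ × ℝ × ℝ) :=
  {p | ∃ x : EuclideanSpace ℂ (Fin n), ‖x‖ = 1 ∧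
    p = ((inner ℂ x (mulVecE A x) : ℂ).re, (inner ℂ x (mulVecE A x) : ℂ).im, ‖mulVecE A x‖ ^ 2)}

/-- The constrained gain range: the gains in the Davis-Wielandt shell that occur at a point whose
phase is outside `(-θ, θ)`. -/
def constrainedGainRange {n : ℕ} (θ : ℝ) (A : Matrix (Fin n) (Fin n) ℂ) : Set ℝ :=
  {h | 0 ≤ h ∧ ∃ z : ℂ, Complex.arg z ∉ Set.Ioo (-θ) θ ∧ (z.re, z.im, h ^ 2) ∈ DWShell A}

/-- The constrained gain `γ_θ(A)`. The range is bounded by the largest singular value; the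
constrained gain is `0` if no point of the shell satisfies the phase constraint. -/
def constrainedGain {n : ℕ} (θ : ℝ) (A : Matrix (Fin n) (Fin n) ℂ) : ℝ :=
  sSup (constrainedGainRange θ A)

/-! ### Real-rational transfer matrices -/

/-- A real-rational function belongs to `RH∞`: it is proper and has no pole in the closed right
half-plane. -/
def IsStableFun (f : RatFunc ℝ) : Prop :=
  f.num.natDegree ≤ f.denom.natDegree ∧
    ∀ s : ℂ, 0 ≤ s.re → Polynomial.aeval s f.denom ≠ 0

/-- A real-rational transfer matrix all of whose entries are in `RH∞`. -/
def IsStable {m p : Type*} (G : Matrix m p (RatFunc ℝ)) : Prop :=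
  ∀ i k, IsStableFun (G i k)

/-- The value at infinity of a proper rational function. -/
def valueAtInfty (f : RatFunc ℝ) : ℝ :=
  f.num.coeff f.denom.natDegree / f.denom.leadingCoeff

open Classical in
/-- The frequency response `G(jω)`, for `ω` in `[-∞, ∞]`. -/
def freqResp {n : ℕ} (G : Matrix (Fin n) (Fin n) (RatFunc ℝ)) (ω : EReal) :
    Matrix (Fin n) (Fin n) ℂ :=
  if ω = ⊤ ∨ ω = ⊥ then G.map (fun f => (valueAtInfty f : ℂ))
  else G.map (RatFunc.eval (algebraMap ℝ ℂ) (Complex.I * (ω.toReal : ℂ)))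

/-- `G(jω)` is sectorial at all frequencies in `[-∞, ∞]`. -/
def IsFreqwiseSectorial {n : ℕ} (G : Matrix (Fin n) (Fin n) (RatFunc ℝ)) : Prop :=
  ∀ ω : EReal, IsSectorial (freqResp G ω)

/-- The Gang of Four transfer matrix `P # C = [I; P] (I + C P)⁻¹ [I, C]`. -/
def gangOfFour {n : ℕ} (P C : Matrix (Fin n) (Fin n) (RatFunc ℝ)) :
    Matrix (Fin n ⊕ Fin n) (Fin n ⊕ Fin n) (RatFunc ℝ) :=
  Matrix.fromRows 1 P * (1 + C * P)⁻¹ * Matrix.fromCols 1 C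

/-- The feedback interconnection of `P` and `C` is stable: `I + C P` is invertible as a matrix of
rational functions, and the Gang of Four transfer matrix is in `RH∞`. -/
def IsFeedbackStable {n : ℕ} (P C : Matrix (Fin n) (Fin n) (RatFunc ℝ)) : Prop :=
  IsUnit (1 + C * P).det ∧ IsStable (gangOfFour P C)

end MixedGainPhase

end

namespace MixedGainPhase

/-! ### Continuity of roots -/

/-! Deform the loop through `I + t C P`, `0 ≤ t ≤ 1`.

At a fixed frequency this matrix is nonsingular (`det_one_add_smul_mul_ne_zero`). If `x = -t C P x`
with `‖x‖ = 1` and `y = P x`, then `x* P x = -t conj (y* C y)`. The phases of `C` keep `y* C y` away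
from the negative axis, so `x* P x` has phase outside `(-θ, θ)` and `‖y‖ ≤ γ_θ(P)`. Hence `1 = t ‖C
y‖ ≤ σ̄(C) γ_θ(P) < 1`, a contradiction.

Now write `P = A / q` and `C = B / r` with Hurwitz `q`, `r`. The polynomial `det (q r I + t B A)`
equals `(q r)^n` at `t = 0`. It has no zero on the imaginary axis, and nonsingularity at infinity
fixes its degree, so no root reaches the right half-plane (`eval_ne_zero_of_homotopy`). At `t = 1`
it is the numerator of `det (I + C P)`, whose inverse is therefore in `RH∞`; the adjugate formula
then gives stability. -/

theorem leadingCoeff_mul_pow_le_norm_eval (p : Polynomial ℂ) (z : ℂ) {ε : ℝ} (hε : 0 ≤ ε)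
    (h : ∀ r, p.IsRoot r → ε ≤ ‖z - r‖) :
    ‖p.leadingCoeff‖ * ε ^ p.natDegree ≤ ‖p.eval z‖ := by
  by_cases hp : p = 0
  · simp [hp]
  have hs := IsAlgClosed.splits p
  conv_rhs => rw [hs.eq_prod_roots]
  rw [Polynomial.eval_mul, Polynomial.eval_C, norm_mul, Polynomial.eval_multiset_prod,
    Multiset.map_map, hs.natDegree_eq_card_roots]
  refine mul_le_mul_of_nonneg_left ?_ (norm_nonneg _)
  have key : ∀ m : Multiset ℂ, (∀ r ∈ m, ε ≤ ‖z - r‖) → ε ^ m.card ≤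
      ‖(m.map (Polynomial.eval z ∘ fun a => Polynomial.X - Polynomial.C a)).prod‖ := by
    intro m
    induction m using Multiset.induction_on with
    | empty => simp
    | cons a m ih =>
      intro hm
      simp only [Multiset.card_cons, Multiset.map_cons, Multiset.prod_cons, norm_mul, pow_succ']
      refine mul_le_mul ?_ (ih fun r hr => hm r (Multiset.mem_cons_of_mem hr)) (by positivity)
        (norm_nonneg _)
      simpa using hm a (Multiset.mem_cons_self a m)
  exact key _ fun r hr => h r ((Polynomial.mem_roots hp).1 hr)

/-- A Cauchy-type root bound; the summand `1` covers roots in the unit disc. It is continuous in the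
coefficients while the `m`-th one is nonzero, so the roots of a whole homotopy lie in one ball. -/
theorem norm_le_of_eval_eq_zero (p : Polynomial ℂ) {m : ℕ} (hdeg : p.natDegree ≤ m)
    (hm : p.coeff m ≠ 0) {z : ℂ} (hz : p.eval z = 0) :
    ‖z‖ ≤ 1 + (∑ i ∈ Finset.range m, ‖p.coeff i‖) / ‖p.coeff m‖ := by
  have hpos : 0 < ‖p.coeff m‖ := norm_pos_iff.2 hm
  have hS : 0 ≤ ∑ i ∈ Finset.range m, ‖p.coeff i‖ := Finset.sum_nonneg fun _ _ => norm_nonneg _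
  rcases le_or_gt ‖z‖ 1 with h1 | h1
  · have := div_nonneg hS hpos.le
    linarith
  rw [Polynomial.eval_eq_sum_range' (Nat.lt_succ_of_le hdeg), Finset.sum_range_succ] at hz
  cases m with
  | zero => simp at hz; exact absurd hz hm
  | succ k =>
    have h2 : ‖p.coeff (k + 1)‖ * ‖z‖ ^ (k + 1) ≤
        (∑ i ∈ Finset.range (k + 1), ‖p.coeff i‖) * ‖z‖ ^ k := by
      rw [← norm_pow, ← norm_mul, eq_neg_of_add_eq_zero_right hz, norm_neg, Finset.sum_mul]
      refine (norm_sum_le _ _).trans (Finset.sum_le_sum fun i hi => ?_)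
      rw [norm_mul, norm_pow]
      have : i ≤ k := Nat.lt_succ_iff.1 (Finset.mem_range.1 hi)
      gcongr
      exact h1.le
    have h3 : ‖p.coeff (k + 1)‖ * ‖z‖ ≤ ∑ i ∈ Finset.range (k + 1), ‖p.coeff i‖ := by
      have hzk : 0 < ‖z‖ ^ k := pow_pos (by linarith) _
      refine le_of_mul_le_mul_right ?_ hzk
      rw [mul_assoc, ← pow_succ']
      exact h2
    have h4 : ‖z‖ ≤ (∑ i ∈ Finset.range (k + 1), ‖p.coeff i‖) / ‖p.coeff (k + 1)‖ := by
      rw [le_div_iff₀ hpos]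
      linarith
    linarith

/-- Roots of a continuous family of polynomials of constant degree cannot enter the right
half-plane without crossing the imaginary axis. -/
theorem eval_ne_zero_of_homotopy (N : ℝ → Polynomial ℂ) (m : ℕ)
    (hdeg : ∀ t, (N t).natDegree ≤ m) (hcont : ∀ i, Continuous fun t => (N t).coeff i)
    (hlc : ∀ t ∈ Set.Icc (0 : ℝ) 1, (N t).coeff m ≠ 0)
    (haxis : ∀ t ∈ Set.Icc (0 : ℝ) 1, ∀ s : ℂ, s.re = 0 → (N t).eval s ≠ 0)
    (h0 : ∀ s : ℂ, 0 ≤ s.re → (N 0).eval s ≠ 0) :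
    ∀ t ∈ Set.Icc (0 : ℝ) 1, ∀ s : ℂ, 0 ≤ s.re → (N t).eval s ≠ 0 := by
  have heval : ∀ t s, (N t).eval s = ∑ i ∈ Finset.range (m + 1), (N t).coeff i * s ^ i :=
    fun t s => Polynomial.eval_eq_sum_range' (Nat.lt_succ_of_le (hdeg t)) s
  have hjoint : Continuous fun q : ℝ × ℂ => (N q.1).eval q.2 := by
    simp only [heval]
    exact continuous_finsetSum _ fun i _ =>
      ((hcont i).comp continuous_fst).mul (continuous_snd.pow i)
  have hbound : ContinuousOn
      (fun t => 1 + (∑ i ∈ Finset.range m, ‖(N t).coeff i‖) / ‖(N t).coeff m‖)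
      (Set.Icc (0 : ℝ) 1) := by
    refine continuousOn_const.add (ContinuousOn.div ?_ ?_ ?_)
    · exact (continuous_finsetSum _ fun i _ => (hcont i).norm).continuousOn
    · exact (hcont m).norm.continuousOn
    · intro t ht
      exact norm_ne_zero_iff.2 (hlc t ht)
  obtain ⟨R, hR⟩ := (isCompact_Icc.image_of_continuousOn hbound).bddAbove
  set S : Set ℝ := {t | t ∈ Set.Icc (0 : ℝ) 1 ∧ ∃ s : ℂ, 0 ≤ s.re ∧ (N t).eval s = 0} with hS
  -- The bad parameters are the projection of a compact set of pairs (parameter, root).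
  have hScompact : IsCompact S := by
    have hK : IsCompact ((Set.Icc (0 : ℝ) 1 ×ˢ Metric.closedBall (0 : ℂ) R) ∩
        {q : ℝ × ℂ | 0 ≤ q.2.re ∧ (N q.1).eval q.2 = 0}) := by
      refine (isCompact_Icc.prod (isCompact_closedBall _ _)).inter_right ?_
      exact (isClosed_le continuous_const (Complex.continuous_re.comp continuous_snd)).inter
        (isClosed_eq hjoint continuous_const)
    convert hK.image continuous_fst using 1
    ext t
    constructor
    · rintro ⟨ht, s, hs, hz⟩
      refine ⟨(t, s), ⟨⟨ht, ?_⟩, hs, hz⟩, rfl⟩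
      rw [mem_closedBall_zero_iff]
      exact (norm_le_of_eval_eq_zero _ (hdeg t) (hlc t ht) hz).trans
        (hR (Set.mem_image_of_mem _ ht))
    · rintro ⟨⟨t', s⟩, ⟨⟨ht, -⟩, hs, hz⟩, rfl⟩
      exact ⟨ht, s, hs, hz⟩
  by_contra! hcon
  obtain ⟨t₁, ht₁, s₁, hs₁, hz₁⟩ := hcon
  obtain ⟨t₀, ⟨ht₀, s₀, hs₀, hz₀⟩, hmin⟩ := hScompact.exists_isLeast ⟨t₁, ht₁, s₁, hs₁, hz₁⟩
  have hs₀pos : 0 < s₀.re := lt_of_le_of_ne hs₀ fun h => haxis t₀ ht₀ s₀ h.symm hz₀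
  have ht₀pos : 0 < t₀ := lt_of_le_of_ne ht₀.1 fun h => h0 s₀ hs₀ (by rw [h]; exact hz₀)
  -- Before the first bad parameter `t₀` all roots lie in the open left half-plane, at distance at
  -- least `Re s₀` from `s₀`. The resulting lower bound on the value at `s₀` survives the limit `t →
  -- t₀` and excludes a zero there.
  have hle : ∀ t ∈ Set.Ico (0 : ℝ) t₀,
      ‖(N t).coeff m‖ * s₀.re ^ m ≤ ‖(N t).eval s₀‖ := by
    intro t ht
    have htI : t ∈ Set.Icc (0 : ℝ) 1 := ⟨ht.1, ht.2.le.trans ht₀.2⟩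
    have hm : (N t).natDegree = m :=
      le_antisymm (hdeg t) (Polynomial.le_natDegree_of_ne_zero (hlc t htI))
    have := leadingCoeff_mul_pow_le_norm_eval (N t) s₀ hs₀ fun r hr => ?_
    · rwa [Polynomial.leadingCoeff, hm] at this
    have hr' : r.re < 0 := by
      by_contra! hge
      exact absurd (hmin ⟨htI, r, hge, hr⟩) (not_le.2 ht.2)
    refine le_trans ?_ (Complex.re_le_norm _)
    rw [Complex.sub_re]
    linarith
  have hlim : ‖(N t₀).coeff m‖ * s₀.re ^ m ≤ ‖(N t₀).eval s₀‖ := by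
    have hcl : t₀ ∈ closure (Set.Ico (0 : ℝ) t₀) := by
      rw [closure_Ico ht₀pos.ne]
      exact ⟨ht₀.1, le_rfl⟩
    refine closure_minimal (s := Set.Ico (0 : ℝ) t₀)
      (t := {t | ‖(N t).coeff m‖ * s₀.re ^ m ≤ ‖(N t).eval s₀‖}) hle ?_ hcl
    exact isClosed_le ((hcont m).norm.mul continuous_const)
      (hjoint.comp (continuous_id.prodMk continuous_const)).norm
  rw [hz₀, norm_zero] at hlim
  have : 0 < ‖(N t₀).coeff m‖ * s₀.re ^ m :=
    mul_pos (norm_pos_iff.2 (hlc t₀ ht₀)) (pow_pos hs₀pos _)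
  linarith

/-! ### The matrix condition -/

/-- A cone of directions with angles in an arc shorter than `π` inside `(-2π, 0)` misses the
positive axis. Rotating the sum by `-m` and by `-M` fixes the sign of its imaginary part, which
gives `sin m ≤ 0 ≤ sin M`. This forces `-π ≤ m` and `M ≤ -π`, so every angle is `-π`. -/
theorem not_pos_of_sum_exp {ι : Type*} [Fintype ι] {c δ : ι → ℝ} {m M ρ : ℝ}
    (hc : ∀ k, 0 ≤ c k) (hm : ∀ k, m ≤ δ k) (hM : ∀ k, δ k ≤ M) (hmM : M - m < Real.pi)
    (hm2 : -(2 * Real.pi) < m) (hM0 : M < 0)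
    (hcos : ∑ k, c k * Real.cos (δ k) = ρ) (hsin : ∑ k, c k * Real.sin (δ k) = 0) :
    ¬ 0 < ρ := by
  intro hρ
  have hrot : ∀ a, ∑ k, c k * Real.sin (δ k - a) = -(ρ * Real.sin a) := by
    intro a
    have : ∀ k, c k * Real.sin (δ k - a) =
        Real.cos a * (c k * Real.sin (δ k)) - Real.sin a * (c k * Real.cos (δ k)) := by
      intro k
      rw [Real.sin_sub]
      ring
    simp only [this, Finset.sum_sub_distrib, ← Finset.mul_sum, hcos, hsin]
    ring
  have hsm : Real.sin m ≤ 0 := by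
    have : 0 ≤ ∑ k, c k * Real.sin (δ k - m) := Finset.sum_nonneg fun k _ =>
      mul_nonneg (hc k) (Real.sin_nonneg_of_nonneg_of_le_pi (by linarith [hm k])
        (by linarith [hM k]))
    rw [hrot] at this
    by_contra! h
    have := mul_pos hρ h
    linarith
  have hsM : 0 ≤ Real.sin M := by
    have : ∑ k, c k * Real.sin (δ k - M) ≤ 0 := Finset.sum_nonpos fun k _ =>
      mul_nonpos_of_nonneg_of_nonpos (hc k)
        (Real.sin_nonpos_of_nonpos_of_neg_pi_le (by linarith [hM k]) (by linarith [hm k]))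
    rw [hrot] at this
    by_contra! h
    have := mul_neg_of_pos_of_neg hρ h
    linarith
  have hm' : -Real.pi ≤ m := by
    by_contra! h
    have := Real.sin_pos_of_pos_of_lt_pi (x := m + 2 * Real.pi) (by linarith) (by linarith)
    rw [Real.sin_add_two_pi] at this
    linarith
  have hM' : M ≤ -Real.pi := by
    by_contra! h
    have := Real.sin_neg_of_neg_of_neg_pi_lt hM0 h
    linarith
  have : ∑ k, c k * Real.cos (δ k) ≤ 0 := Finset.sum_nonpos fun k _ => by
    have hk : δ k = -Real.pi := le_antisymm ((hM k).trans hM') (hm'.trans (hm k))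
    rw [hk, Real.cos_neg, Real.cos_pi]
    linarith [hc k]
  linarith

/-- The weights are `|(T y)_k|²` for the congruence `A = T* D T`. -/
theorem IsPhaseVector.inner_eq_sum {n : ℕ} {A : Matrix (Fin n) (Fin n) ℂ} {φ : Fin n → ℝ}
    (h : IsPhaseVector A φ) (y : EuclideanSpace ℂ (Fin n)) :
    ∃ c : Fin n → ℝ, (∀ k, 0 ≤ c k) ∧
      inner ℂ y (mulVecE A y) = ∑ k, (c k : ℂ) * Complex.exp ((φ k : ℂ) * Complex.I) := by
  obtain ⟨T, -, hT⟩ := h.decomposition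
  refine ⟨fun k => ‖mulVecE T y k‖ ^ 2, fun k => by positivity, ?_⟩
  have hA : mulVecE A y = mulVecE Tᴴ
      (mulVecE (Matrix.diagonal fun k => Complex.exp ((φ k : ℂ) * Complex.I)) (mulVecE T y)) := by
    rw [hT]
    simp [mulVecE, map_mul]
  have hadj : mulVecE Tᴴ = ContinuousLinearMap.adjoint
      (Matrix.toEuclideanCLM (n := Fin n) (𝕜 := ℂ) T) := by
    unfold mulVecE
    rw [← Matrix.star_eq_conjTranspose, map_star, ContinuousLinearMap.star_eq_adjoint]
  rw [hA, hadj, ContinuousLinearMap.adjoint_inner_right, PiLp.inner_apply]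
  refine Finset.sum_congr rfl fun k _ => ?_
  change inner ℂ (mulVecE T y k) _ = _
  have : mulVecE (Matrix.diagonal fun k => Complex.exp ((φ k : ℂ) * Complex.I)) (mulVecE T y) k =
      Complex.exp ((φ k : ℂ) * Complex.I) * mulVecE T y k := by
    simp [mulVecE, Matrix.mulVec_diagonal]
  rw [this, RCLike.inner_apply, mul_assoc, Complex.mul_conj, Complex.normSq_eq_norm_sq, mul_comm]

/-- The default value `π` of `phases` violates the sector inclusion, so the inclusion itself
guarantees a phase vector. -/
theorem isPhaseVector_phases {n : ℕ} [NeZero n] {A : Matrix (Fin n) (Fin n) ℂ} {θ : ℝ}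
    (hθ : 0 ≤ θ) (h : phaseSector A ⊆ Set.Ioo (-Real.pi + θ) (Real.pi - θ)) :
    IsPhaseVector A (phases A) := by
  by_cases hex : ∃ φ : Fin n → ℝ, IsPhaseVector A φ
  · rw [phases, dif_pos hex]
    exact hex.choose_spec
  · have : Real.pi ∈ phaseSector A := by
      simp [phaseSector, lowerPhase, upperPhase, phases, dif_neg hex]
    have := (h this).2
    linarith

theorem inner_mulVecE_ne_zero {n : ℕ} {A : Matrix (Fin n) (Fin n) ℂ} (hA : IsSectorial A)
    {y : EuclideanSpace ℂ (Fin n)} (hy : y ≠ 0) : inner ℂ y (mulVecE A y) ≠ 0 := by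
  intro h
  refine hA ⟨(‖y‖⁻¹ : ℂ) • y, ?_, ?_⟩
  · rw [norm_smul, norm_inv, Complex.norm_real, norm_norm, inv_mul_cancel₀ (norm_ne_zero_iff.2 hy)]
  · have : mulVecE A ((‖y‖⁻¹ : ℂ) • y) = (‖y‖⁻¹ : ℂ) • mulVecE A y := map_smul _ _ _
    rw [this, inner_smul_left, inner_smul_right, h]
    simp

theorem norm_mulVecE_le_constrainedGain {n : ℕ} {A : Matrix (Fin n) (Fin n) ℂ} {θ : ℝ}
    {x : EuclideanSpace ℂ (Fin n)} (hx : ‖x‖ = 1)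
    (harg : Complex.arg (inner ℂ x (mulVecE A x)) ∉ Set.Ioo (-θ) θ) :
    ‖mulVecE A x‖ ≤ constrainedGain θ A := by
  refine le_csSup ⟨sigmaMax A, ?_⟩ ⟨norm_nonneg _, _, harg, x, hx, rfl⟩
  rintro h ⟨h0, z, -, u, hu, he⟩
  have h2 : h ^ 2 = ‖mulVecE A u‖ ^ 2 := congrArg (fun p : ℝ × ℝ × ℝ => p.2.2) he
  rw [(sq_eq_sq₀ h0 (norm_nonneg _)).1 h2]
  have := (Matrix.toEuclideanCLM (n := Fin n) (𝕜 := ℂ) A).le_opNorm u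
  rwa [hu, mul_one] at this

theorem arg_neg_smul_conj_notMem {n : ℕ} [NeZero n] {B : Matrix (Fin n) (Fin n) ℂ}
    (hB : IsSectorial B) {θ : ℝ} (hθ : 0 ≤ θ)
    (hphase : phaseSector B ⊆ Set.Ioo (-Real.pi + θ) (Real.pi - θ))
    {y : EuclideanSpace ℂ (Fin n)} (hy : y ≠ 0) {t : ℝ} (ht : 0 < t) {z : ℂ}
    (hz : z = -(t * starRingEnd ℂ (inner ℂ y (mulVecE B y)))) :
    Complex.arg z ∉ Set.Ioo (-θ) θ := by
  intro harg
  have hw := inner_mulVecE_ne_zero hB hy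
  have hv := isPhaseVector_phases hθ hphase
  obtain ⟨c, hc, hsum⟩ := hv.inner_eq_sum y
  set w : ℂ := inner ℂ y (mulVecE B y) with hw_def
  have hz0 : z ≠ 0 := by
    rw [hz]
    simpa [ht.ne'] using hw
  have hlow : ∀ k, lowerPhase B ≤ phases B k := fun k =>
    ciInf_le (Set.finite_range _).bddBelow k
  have hupp : ∀ k, phases B k ≤ upperPhase B := fun k =>
    le_ciSup (Set.finite_range _).bddAbove k
  have hlu : lowerPhase B ≤ upperPhase B := (hlow 0).trans (hupp 0)
  have h1 := hphase (Set.left_mem_Icc.2 hlu)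
  have h2 := hphase (Set.right_mem_Icc.2 hlu)
  have hspread : upperPhase B - lowerPhase B < Real.pi := hv.spread
  set α := Complex.arg z with hα
  -- Since `w = (‖z‖ / t) exp (i (π - α))`, rotating by `-(π - α)` makes the sum a positive real.
  have hrot : ∑ k, (c k : ℂ) *
      Complex.exp (((phases B k - (Real.pi - α) : ℝ) : ℂ) * Complex.I) = ((‖z‖ / t : ℝ) : ℂ) := by
    have hwz : w = -(starRingEnd ℂ z) / t := by
      have : (t : ℂ) ≠ 0 := by exact_mod_cast ht.ne'
      rw [hz]
      simp [this]
    have hzc : starRingEnd ℂ z = ‖z‖ * Complex.exp (-(α * Complex.I)) := by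
      conv_lhs => rw [← Complex.norm_mul_exp_arg_mul_I z]
      rw [map_mul, ← Complex.exp_conj]
      simp [hα]
    have : ∀ k, (c k : ℂ) * Complex.exp (((phases B k - (Real.pi - α) : ℝ) : ℂ) * Complex.I) =
        ((c k : ℂ) * Complex.exp ((phases B k : ℂ) * Complex.I)) *
          (-Complex.exp (α * Complex.I)) := by
      intro k
      rw [mul_assoc, ← neg_one_mul (Complex.exp (α * Complex.I)), ← Complex.exp_neg_pi_mul_I,
        ← Complex.exp_add, ← Complex.exp_add]
      congr 2
      push_cast
      ring
    simp only [this, ← Finset.sum_mul, ← hsum]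
    rw [hwz, hzc]
    have hee : Complex.exp (-(α * Complex.I)) * Complex.exp (α * Complex.I) = 1 := by
      rw [← Complex.exp_add]
      simp
    push_cast
    linear_combination ((‖z‖ : ℂ) / t) * hee
  -- The sector inclusion together with `|α| < θ` puts all shifted phases in `(-2π, 0)`.
  refine not_pos_of_sum_exp (m := lowerPhase B - (Real.pi - α)) (M := upperPhase B - (Real.pi - α))
    (δ := fun k => phases B k - (Real.pi - α)) hc (fun k => by linarith [hlow k])
    (fun k => by linarith [hupp k]) (by linarith) (by linarith [h1.1, harg.1])
    (by linarith [h2.2, harg.2]) ?_ ?_ (div_pos (norm_pos_iff.2 hz0) ht)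
  · have := congrArg Complex.re hrot
    simpa only [Complex.re_sum, Complex.re_ofReal_mul, Complex.exp_ofReal_mul_I_re,
      Complex.ofReal_re] using this
  · have := congrArg Complex.im hrot
    simpa only [Complex.im_sum, Complex.im_ofReal_mul, Complex.exp_ofReal_mul_I_im,
      Complex.ofReal_im] using this

/-- The matrix small gain condition with a phase constraint. -/
theorem det_one_add_smul_mul_ne_zero {n : ℕ} {A B : Matrix (Fin n) (Fin n) ℂ}
    (hB : IsSectorial B) {θ : ℝ} (hθ : 0 ≤ θ)
    (hgain : constrainedGain θ A * sigmaMax B < 1)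
    (hphase : phaseSector B ⊆ Set.Ioo (-Real.pi + θ) (Real.pi - θ)) {t : ℝ}
    (ht : t ∈ Set.Icc (0 : ℝ) 1) :
    (1 + (t : ℂ) • (B * A)).det ≠ 0 := by
  intro hdet
  obtain ⟨v, hv0, hv⟩ := Matrix.exists_mulVec_eq_zero_iff.2 hdet
  have hn : NeZero n := ⟨by
    rintro rfl
    exact hv0 (Subsingleton.elim _ _)⟩
  have hE : ∀ u : EuclideanSpace ℂ (Fin n), u + (t : ℂ) • mulVecE B (mulVecE A u) = 0 →
      ‖u‖ = 1 → False := by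
    intro x hx hx1
    have hxe : x = -((t : ℂ) • mulVecE B (mulVecE A x)) := eq_neg_of_add_eq_zero_left hx
    have ht0 : 0 < t := lt_of_le_of_ne ht.1 fun h => by
      rw [← h] at hxe
      simp at hxe
      simp [hxe] at hx1
    have hy : mulVecE A x ≠ 0 := fun h => by
      have : x = 0 := by
        rw [hxe, h]
        simp [mulVecE]
      simp [this] at hx1
    have hz : inner ℂ x (mulVecE A x) =
        -(t * starRingEnd ℂ (inner ℂ (mulVecE A x) (mulVecE B (mulVecE A x)))) := by
      -- Only the first, conjugate-linear argument is replaced by `-t B A x`.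
      refine (congrArg (fun u => inner ℂ u (mulVecE A x)) hxe).trans ?_
      simp only [inner_conj_symm, inner_neg_left, inner_smul_left, Complex.conj_ofReal]
    have h1 := norm_mulVecE_le_constrainedGain hx1
      (arg_neg_smul_conj_notMem hB hθ hphase hy ht0 hz)
    have h2 : ‖mulVecE B (mulVecE A x)‖ ≤ sigmaMax B * ‖mulVecE A x‖ :=
      (Matrix.toEuclideanCLM (n := Fin n) (𝕜 := ℂ) B).le_opNorm _
    have h3 : (1 : ℝ) = t * ‖mulVecE B (mulVecE A x)‖ := by
      have := congrArg norm hxe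
      rwa [hx1, norm_neg, norm_smul, Complex.norm_real, Real.norm_of_nonneg ht.1] at this
    have h4 : t * ‖mulVecE B (mulVecE A x)‖ ≤ ‖mulVecE B (mulVecE A x)‖ :=
      mul_le_of_le_one_left (norm_nonneg _) ht.2
    have h5 : sigmaMax B * ‖mulVecE A x‖ ≤ sigmaMax B * constrainedGain θ A :=
      mul_le_mul_of_nonneg_left h1 (norm_nonneg _)
    linarith
  set u : EuclideanSpace ℂ (Fin n) := WithLp.toLp 2 v with hu
  have hu0 : u ≠ 0 := fun h => hv0 (by simpa [hu] using h)
  have hueq : u + (t : ℂ) • mulVecE B (mulVecE A u) = 0 := by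
    have : WithLp.toLp 2 ((1 + (t : ℂ) • (B * A)) *ᵥ v) = (0 : EuclideanSpace ℂ (Fin n)) := by
      rw [hv]
      rfl
    rw [Matrix.add_mulVec, Matrix.one_mulVec, Matrix.smul_mulVec, ← Matrix.mulVec_mulVec] at this
    exact this
  have hnu : ‖u‖ ≠ 0 := norm_ne_zero_iff.2 hu0
  refine hE ((‖u‖⁻¹ : ℂ) • u) ?_ ?_
  · have : mulVecE B (mulVecE A ((‖u‖⁻¹ : ℂ) • u)) = (‖u‖⁻¹ : ℂ) • mulVecE B (mulVecE A u) := by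
      simp [mulVecE]
    rw [this, smul_comm, ← smul_add, hueq, smul_zero]
  · rw [norm_smul, norm_inv, Complex.norm_real, norm_norm, inv_mul_cancel₀ hnu]

/-! ### Stable rational functions -/

/-- A real polynomial without roots in the closed right half-plane. -/
def IsHurwitz (q : Polynomial ℝ) : Prop :=
  ∀ s : ℂ, 0 ≤ s.re → Polynomial.aeval s q ≠ 0

theorem IsHurwitz.ne_zero {q : Polynomial ℝ} (hq : IsHurwitz q) : q ≠ 0 := by
  rintro rfl
  exact hq 0 le_rfl (map_zero _)

theorem IsHurwitz.mul {q r : Polynomial ℝ} (hq : IsHurwitz q) (hr : IsHurwitz r) :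
    IsHurwitz (q * r) := fun s hs => by
  rw [map_mul]
  exact mul_ne_zero (hq s hs) (hr s hs)

theorem IsHurwitz.pow {q : Polynomial ℝ} (hq : IsHurwitz q) (k : ℕ) : IsHurwitz (q ^ k) :=
  fun s hs => by
    rw [map_pow]
    exact pow_ne_zero _ (hq s hs)

theorem isHurwitz_one : IsHurwitz 1 := fun s _ => by simp

theorem IsHurwitz.of_dvd {q r : Polynomial ℝ} (hq : IsHurwitz q) (h : r ∣ q) : IsHurwitz r := by
  obtain ⟨u, rfl⟩ := h
  intro s hs h0
  exact hq s hs (by rw [map_mul, h0, zero_mul])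

theorem IsHurwitz.prod {ι : Type*} {s : Finset ι} {q : ι → Polynomial ℝ}
    (hq : ∀ i ∈ s, IsHurwitz (q i)) : IsHurwitz (∏ i ∈ s, q i) :=
  Finset.prod_induction q IsHurwitz (fun _ _ => IsHurwitz.mul) isHurwitz_one hq

/-- The fraction of two real polynomials. -/
noncomputable abbrev fraction (a q : Polynomial ℝ) : RatFunc ℝ :=
  algebraMap (Polynomial ℝ) (RatFunc ℝ) a / algebraMap (Polynomial ℝ) (RatFunc ℝ) q

theorem num_mul_eq_of_fraction (a : Polynomial ℝ) {q : Polynomial ℝ} (hq : q ≠ 0) :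
    (fraction a q).num * q = a * (fraction a q).denom :=
  (RatFunc.num_mul_eq_mul_denom_iff hq).2 rfl

/-- Cancelling common factors only removes roots of the denominator and preserves the degree
difference. Stability can thus be checked on fractions that are not in lowest terms. -/
theorem isStableFun_fraction {a q : Polynomial ℝ} (hq : IsHurwitz q)
    (hdeg : a.natDegree ≤ q.natDegree) : IsStableFun (fraction a q) := by
  refine ⟨?_, hq.of_dvd (RatFunc.denom_div_dvd a q)⟩
  by_cases ha : a = 0
  · simp [ha]
  have hcross := num_mul_eq_of_fraction a hq.ne_zero
  have hnum : (fraction a q).num ≠ 0 := fun h => by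
    rw [h, zero_mul] at hcross
    exact mul_ne_zero ha (RatFunc.denom_ne_zero _) hcross.symm
  have h := congrArg Polynomial.natDegree hcross
  rw [Polynomial.natDegree_mul hnum hq.ne_zero,
    Polynomial.natDegree_mul ha (RatFunc.denom_ne_zero _)] at h
  omega

theorem isStableFun_iff {f : RatFunc ℝ} : IsStableFun f ↔ ∃ a q : Polynomial ℝ,
    IsHurwitz q ∧ a.natDegree ≤ q.natDegree ∧ f = fraction a q := by
  constructor
  · rintro ⟨hdeg, hden⟩
    exact ⟨f.num, f.denom, hden, hdeg, (RatFunc.num_div_denom f).symm⟩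
  · rintro ⟨a, q, hq, hdeg, rfl⟩
    exact isStableFun_fraction hq hdeg

theorem isStableFun_algebraMap (c : ℝ) : IsStableFun (algebraMap ℝ (RatFunc ℝ) c) :=
  isStableFun_iff.2 ⟨Polynomial.C c, 1, isHurwitz_one, by simp, by simp [fraction]⟩

theorem algebraMap_ne_zero_of_isHurwitz {q : Polynomial ℝ} (hq : IsHurwitz q) :
    algebraMap (Polynomial ℝ) (RatFunc ℝ) q ≠ 0 :=
  RatFunc.algebraMap_ne_zero hq.ne_zero

theorem IsStableFun.mul {f g : RatFunc ℝ} (hf : IsStableFun f) (hg : IsStableFun g) :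
    IsStableFun (f * g) := by
  obtain ⟨a, q, hq, hd, rfl⟩ := isStableFun_iff.1 hf
  obtain ⟨b, r, hr, he, rfl⟩ := isStableFun_iff.1 hg
  refine isStableFun_iff.2 ⟨a * b, q * r, hq.mul hr, ?_, ?_⟩
  · rw [Polynomial.natDegree_mul hq.ne_zero hr.ne_zero]
    exact Polynomial.natDegree_mul_le_of_le hd he
  · simp only [fraction, map_mul]
    exact div_mul_div_comm _ _ _ _

theorem IsStableFun.add {f g : RatFunc ℝ} (hf : IsStableFun f) (hg : IsStableFun g) :
    IsStableFun (f + g) := by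
  obtain ⟨a, q, hq, hd, rfl⟩ := isStableFun_iff.1 hf
  obtain ⟨b, r, hr, he, rfl⟩ := isStableFun_iff.1 hg
  refine isStableFun_iff.2 ⟨a * r + q * b, q * r, hq.mul hr, ?_, ?_⟩
  · rw [Polynomial.natDegree_mul hq.ne_zero hr.ne_zero]
    exact Polynomial.natDegree_add_le_of_degree_le (Polynomial.natDegree_mul_le_of_le hd le_rfl)
      (Polynomial.natDegree_mul_le_of_le le_rfl he)
  · simp only [fraction, map_mul, map_add]
    exact div_add_div _ _ (algebraMap_ne_zero_of_isHurwitz hq) (algebraMap_ne_zero_of_isHurwitz hr)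

/-- The ring `RH∞`. -/
def stableRing : Subring (RatFunc ℝ) where
  carrier := {f | IsStableFun f}
  mul_mem' := IsStableFun.mul
  add_mem' := IsStableFun.add
  one_mem' := by simpa using isStableFun_algebraMap 1
  zero_mem' := by simpa using isStableFun_algebraMap 0
  neg_mem' := fun {f} hf => by
    have h := IsStableFun.mul (isStableFun_algebraMap (-1)) hf
    simpa using h

theorem isStable_one {m : Type*} [DecidableEq m] : IsStable (1 : Matrix m m (RatFunc ℝ)) := by
  intro i k
  rw [Matrix.one_apply]
  split_ifs
  exacts [stableRing.one_mem, stableRing.zero_mem]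

theorem IsStable.mul {l m p : Type*} [Fintype m] {G : Matrix l m (RatFunc ℝ)}
    {H : Matrix m p (RatFunc ℝ)} (hG : IsStable G) (hH : IsStable H) : IsStable (G * H) :=
  fun i k => stableRing.sum_mem fun j _ => stableRing.mul_mem (hG i j) (hH j k)

/-- Cramer's rule: the adjugate is computed inside the ring `RH∞`, so only the inverse determinant
matters. -/
theorem IsStable.inv {n : ℕ} {G : Matrix (Fin n) (Fin n) (RatFunc ℝ)} (hG : IsStable G)
    (hdet : IsStableFun G.det⁻¹) : IsStable G⁻¹ := by
  let G' : Matrix (Fin n) (Fin n) stableRing := fun i k => ⟨G i k, hG i k⟩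
  have hG' : stableRing.subtype.mapMatrix G' = G := rfl
  intro i k
  rw [Matrix.inv_def, Ring.inverse_eq_inv', Matrix.smul_apply, smul_eq_mul, ← hG',
    ← RingHom.map_adjugate]
  exact stableRing.mul_mem hdet (G'.adjugate i k).2

theorem IsStable.exists_common_denominator {n : ℕ} {G : Matrix (Fin n) (Fin n) (RatFunc ℝ)}
    (hG : IsStable G) : ∃ (q : Polynomial ℝ) (A : Matrix (Fin n) (Fin n) (Polynomial ℝ)),
      IsHurwitz q ∧ (∀ i k, (A i k).natDegree ≤ q.natDegree) ∧
        ∀ i k, G i k = fraction (A i k) q := by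
  let d : Fin n × Fin n → Polynomial ℝ := fun j => (G j.1 j.2).denom
  have hd : ∀ j, d j ≠ 0 := fun j => RatFunc.denom_ne_zero _
  refine ⟨∏ j, d j, fun i k => (G i k).num * ∏ j ∈ Finset.univ.erase (i, k), d j,
    IsHurwitz.prod fun j _ => (hG j.1 j.2).2, fun i k => ?_, fun i k => ?_⟩
  all_goals rw [← Finset.mul_prod_erase _ d (Finset.mem_univ (i, k))]
  · have hp : ∏ j ∈ Finset.univ.erase (i, k), d j ≠ 0 :=
      Finset.prod_ne_zero_iff.2 fun j _ => hd j
    rw [Polynomial.natDegree_mul (hd _) hp]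
    exact Polynomial.natDegree_mul_le_of_le (hG i k).1 le_rfl
  · have hp : ∏ j ∈ Finset.univ.erase (i, k), d j ≠ 0 :=
      Finset.prod_ne_zero_iff.2 fun j _ => hd j
    simp only [fraction, map_mul]
    rw [mul_div_mul_right _ _ (RatFunc.algebraMap_ne_zero hp)]
    exact (RatFunc.num_div_denom _).symm

theorem eval_fraction (a : Polynomial ℝ) {q : Polynomial ℝ} {s : ℂ}
    (hs : Polynomial.aeval s q ≠ 0) :
    RatFunc.eval (algebraMap ℝ ℂ) s (fraction a q) =
      (Polynomial.aeval s q)⁻¹ * Polynomial.aeval s a := by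
  have hq : q ≠ 0 := by
    rintro rfl
    exact hs (map_zero _)
  have hden : Polynomial.aeval s (fraction a q).denom ≠ 0 := by
    obtain ⟨u, hu⟩ := RatFunc.denom_div_dvd a q
    intro h
    apply hs
    rw [hu, map_mul, h, zero_mul]
  have hcross := congrArg (Polynomial.aeval s) (num_mul_eq_of_fraction a hq)
  rw [map_mul, map_mul] at hcross
  change Polynomial.aeval s _ / Polynomial.aeval s _ = _
  rw [inv_mul_eq_div, div_eq_div_iff hden hs]
  exact hcross

/-- Compare the coefficients of the cross-multiplied identity at the sum of the two denominator
degrees. -/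
theorem valueAtInfty_fraction {a q : Polynomial ℝ} (hq : IsHurwitz q)
    (hdeg : a.natDegree ≤ q.natDegree) :
    valueAtInfty (fraction a q) = (q.coeff q.natDegree)⁻¹ * a.coeff q.natDegree := by
  have hcross := congrArg (fun p => p.coeff ((fraction a q).denom.natDegree + q.natDegree))
    (num_mul_eq_of_fraction a hq.ne_zero)
  rw [Polynomial.coeff_mul_add_eq_of_natDegree_le (isStableFun_fraction hq hdeg).1 le_rfl,
    add_comm, Polynomial.coeff_mul_add_eq_of_natDegree_le hdeg le_rfl] at hcross
  rw [valueAtInfty, Polynomial.leadingCoeff, inv_mul_eq_div, div_eq_div_iff]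
  · exact hcross
  · exact Polynomial.leadingCoeff_ne_zero.2 (RatFunc.denom_ne_zero _)
  · exact Polynomial.leadingCoeff_ne_zero.2 hq.ne_zero

/-! ### Determinants of polynomial matrices -/

theorem natDegree_det_le {R : Type*} [CommRing R] {n e : ℕ}
    {M : Matrix (Fin n) (Fin n) (Polynomial R)} (hM : ∀ i k, (M i k).natDegree ≤ e) :
    M.det.natDegree ≤ n * e := by
  rw [Matrix.det_apply]
  refine Polynomial.natDegree_sum_le_of_forall_le _ _ fun σ _ => ?_
  refine (Polynomial.natDegree_smul_le _ _).trans ((Polynomial.natDegree_prod_le _ _).trans ?_)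
  exact (Finset.sum_le_sum fun i _ => hM (σ i) i).trans (by simp)

/-- In each Leibniz term the coefficient at `n * e` is the product of the coefficients at `e`. These
may vanish, since `e` is only an upper bound for the degrees. -/
theorem coeff_det {R : Type*} [CommRing R] {n e : ℕ}
    {M : Matrix (Fin n) (Fin n) (Polynomial R)} (hM : ∀ i k, (M i k).natDegree ≤ e) :
    M.det.coeff (n * e) = (M.map fun p => p.coeff e).det := by
  rw [Matrix.det_apply, Matrix.det_apply, Polynomial.finsetSum_coeff]
  refine Finset.sum_congr rfl fun σ _ => ?_
  rw [Polynomial.coeff_smul]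
  congr 1
  simpa using Polynomial.coeff_prod_of_natDegree_le Finset.univ (fun i => M (σ i) i) e
    fun i _ => hM (σ i) i

/-- The pencil `det (b I + t A)` of a polynomial matrix `A` and a polynomial `b`. -/
noncomputable def detPencil {n : ℕ} (b : Polynomial ℝ) (A : Matrix (Fin n) (Fin n) (Polynomial ℝ)) (t : ℝ) :
    Polynomial ℝ :=
  (b • (1 : Matrix (Fin n) (Fin n) (Polynomial ℝ)) + Polynomial.C t • A).det

variable {n e : ℕ} {b : Polynomial ℝ} {A : Matrix (Fin n) (Fin n) (Polynomial ℝ)}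

theorem natDegree_pencil_le (hb : b.natDegree ≤ e) (hA : ∀ i k, (A i k).natDegree ≤ e) (t : ℝ)
    (i k : Fin n) :
    ((b • (1 : Matrix (Fin n) (Fin n) (Polynomial ℝ)) + Polynomial.C t • A) i k).natDegree ≤
      e := by
  simp only [Matrix.add_apply, Matrix.smul_apply, smul_eq_mul]
  refine Polynomial.natDegree_add_le_of_degree_le ?_
    ((Polynomial.natDegree_C_mul_le _ _).trans (hA i k))
  rw [Matrix.one_apply]
  split_ifs <;> simp [hb]

theorem coeff_detPencil (hb : b.natDegree ≤ e) (hA : ∀ i k, (A i k).natDegree ≤ e) (t : ℝ) :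
    (detPencil b A t).coeff (n * e) =
      (b.coeff e • (1 : Matrix (Fin n) (Fin n) ℝ) + t • A.map fun p => p.coeff e).det := by
  rw [detPencil, coeff_det (natDegree_pencil_le hb hA t)]
  congr 1
  ext i k
  simp only [Matrix.map_apply, Matrix.add_apply, Matrix.smul_apply, smul_eq_mul,
    Polynomial.coeff_add, Polynomial.coeff_C_mul, Matrix.one_apply]
  split_ifs <;> simp

theorem aeval_detPencil (t : ℝ) (s : ℂ) :
    Polynomial.aeval s (detPencil b A t) =
      (Polynomial.aeval s b • (1 : Matrix (Fin n) (Fin n) ℂ) +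
        (t : ℂ) • A.map (Polynomial.aeval s)).det := by
  rw [detPencil, AlgHom.map_det]
  congr 1
  ext i k
  simp only [AlgHom.mapMatrix_apply, Matrix.map_apply, Matrix.add_apply, Matrix.smul_apply,
    smul_eq_mul, map_add, map_mul, Matrix.one_apply, Polynomial.aeval_C, Complex.coe_algebraMap]
  split_ifs <;> simp

theorem continuous_coeff_detPencil (i : ℕ) : Continuous fun t => (detPencil b A t).coeff i := by
  -- With `t` as a second indeterminate, each coefficient is visibly a polynomial in `t`.
  let D : Polynomial (Polynomial ℝ) :=
    (Polynomial.C b • (1 : Matrix (Fin n) (Fin n) (Polynomial (Polynomial ℝ))) +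
      (Polynomial.X : Polynomial (Polynomial ℝ)) • A.map Polynomial.C).det
  have hD : ∀ t, detPencil b A t = D.eval (Polynomial.C t) := by
    intro t
    rw [← Polynomial.coe_evalRingHom, RingHom.map_det, detPencil]
    congr 1
    ext1 i k
    simp only [RingHom.mapMatrix_apply, Matrix.map_apply, Matrix.add_apply, Matrix.smul_apply,
      smul_eq_mul, map_add, Matrix.one_apply, Polynomial.coe_evalRingHom]
    split_ifs <;> simp [mul_comm (A i k)]
  simp only [hD, Polynomial.eval_eq_sum_range, Polynomial.finsetSum_coeff, ← Polynomial.C_pow,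
    Polynomial.coeff_mul_C]
  fun_prop

/-- A pencil that does not vanish on the extended imaginary axis is Hurwitz if its initial
polynomial is. -/
theorem isHurwitz_detPencil (hbH : IsHurwitz b) (hA : ∀ i k, (A i k).natDegree ≤ b.natDegree)
    (haxis : ∀ t ∈ Set.Icc (0 : ℝ) 1, ∀ ω : ℝ, 0 ≤ ω →
      Polynomial.aeval (Complex.I * ω) (detPencil b A t) ≠ 0)
    (hinf : ∀ t ∈ Set.Icc (0 : ℝ) 1, (detPencil b A t).coeff (n * b.natDegree) ≠ 0) :
    IsHurwitz (detPencil b A 1) := by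
  have key := eval_ne_zero_of_homotopy
    (fun t => (detPencil b A t).map (algebraMap ℝ ℂ)) (n * b.natDegree)
    (fun t => Polynomial.natDegree_map_le.trans
      (natDegree_det_le (natDegree_pencil_le le_rfl hA t)))
    (fun i => by
      simp only [Polynomial.coeff_map]
      exact Complex.continuous_ofReal.comp (continuous_coeff_detPencil i))
    (fun t ht => by
      rw [Polynomial.coeff_map]
      exact Complex.ofReal_ne_zero.2 (hinf t ht))
    (fun t ht s hs => by
      rw [Polynomial.eval_map_algebraMap]
      rcases le_total 0 s.im with h | h
      · have := haxis t ht s.im h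
        rwa [show Complex.I * (s.im : ℂ) = s by apply Complex.ext <;> simp [hs]] at this
      -- Real coefficients: a zero at a negative frequency is conjugate to one at a positive
      -- frequency.
      · have := haxis t ht (-s.im) (neg_nonneg.2 h)
        rw [show Complex.I * ((-s.im : ℝ) : ℂ) = starRingEnd ℂ s by
          apply Complex.ext <;> simp [hs], Polynomial.aeval_conj] at this
        exact fun h0 => this (by rw [h0, map_zero]))
    (fun s hs => by
      rw [Polynomial.eval_map_algebraMap, aeval_detPencil]
      simpa using fun h0 => absurd h0 (hbH s hs))
  intro s hs
  have := key 1 (Set.right_mem_Icc.2 zero_le_one) s hs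
  rwa [Polynomial.eval_map_algebraMap] at this

/-! ### From frequency responses to the determinant of the return difference -/

theorem det_smul_one_add_ne_zero {n : ℕ} {P C : Matrix (Fin n) (Fin n) ℂ} {x y : ℂ} (hx : x ≠ 0)
    (hy : y ≠ 0) {t : ℂ} (h : (1 + t • ((y⁻¹ • C) * (x⁻¹ • P))).det ≠ 0) :
    ((x * y) • (1 : Matrix (Fin n) (Fin n) ℂ) + t • (C * P)).det ≠ 0 := by
  have : (x * y) • (1 : Matrix (Fin n) (Fin n) ℂ) + t • (C * P) =
      (x * y) • (1 + t • ((y⁻¹ • C) * (x⁻¹ • P))) := by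
    rw [Matrix.smul_mul, Matrix.mul_smul, smul_add, smul_smul, smul_smul, smul_smul]
    congr 2
    field_simp
  rw [this, Matrix.det_smul]
  exact mul_ne_zero (pow_ne_zero _ (mul_ne_zero hx hy)) h

theorem freqResp_of_fraction {n : ℕ} {G : Matrix (Fin n) (Fin n) (RatFunc ℝ)}
    {q : Polynomial ℝ} {A : Matrix (Fin n) (Fin n) (Polynomial ℝ)} (hq : IsHurwitz q)
    (hG : ∀ i k, G i k = fraction (A i k) q) (ω : ℝ) :
    freqResp G ω = (Polynomial.aeval (Complex.I * ω) q)⁻¹ •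
      A.map (Polynomial.aeval (Complex.I * (ω : ℂ))) := by
  rw [freqResp, if_neg (by simp)]
  ext i k
  rw [Matrix.map_apply, hG, EReal.toReal_coe, eval_fraction _ (hq _ (by simp))]
  rfl

theorem freqResp_top_of_fraction {n : ℕ} {G : Matrix (Fin n) (Fin n) (RatFunc ℝ)}
    {q : Polynomial ℝ} {A : Matrix (Fin n) (Fin n) (Polynomial ℝ)} (hq : IsHurwitz q)
    (hA : ∀ i k, (A i k).natDegree ≤ q.natDegree) (hG : ∀ i k, G i k = fraction (A i k) q) :
    freqResp G ⊤ = ((q.coeff q.natDegree : ℝ) : ℂ)⁻¹ •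
      A.map (fun p => ((p.coeff q.natDegree : ℝ) : ℂ)) := by
  rw [freqResp, if_pos (Or.inl rfl)]
  ext i k
  rw [Matrix.map_apply, hG, valueAtInfty_fraction hq (hA i k)]
  simp

/-- Nonsingularity of `I + t C P` on the extended imaginary axis, for all `t` in `[0, 1]`, makes
`I + C P` invertible with an inverse determinant in `RH∞`. -/
theorem isStableFun_inv_det {n : ℕ} {P C : Matrix (Fin n) (Fin n) (RatFunc ℝ)} (hP : IsStable P)
    (hC : IsStable C)
    (h : ∀ ω : EReal, 0 ≤ ω → ∀ t ∈ Set.Icc (0 : ℝ) 1,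
      (1 + (t : ℂ) • (freqResp C ω * freqResp P ω)).det ≠ 0) :
    (1 + C * P).det ≠ 0 ∧ IsStableFun (1 + C * P).det⁻¹ := by
  obtain ⟨q, A, hq, hA, hPA⟩ := hP.exists_common_denominator
  obtain ⟨r, B, hr, hB, hCB⟩ := hC.exists_common_denominator
  have hdeg : (q * r).natDegree = r.natDegree + q.natDegree := by
    rw [Polynomial.natDegree_mul hq.ne_zero hr.ne_zero, add_comm]
  have hBA : ∀ i k, ((B * A) i k).natDegree ≤ (q * r).natDegree := fun i k => by
    rw [hdeg, Matrix.mul_apply]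
    exact Polynomial.natDegree_sum_le_of_forall_le _ _ fun j _ =>
      Polynomial.natDegree_mul_le_of_le (hB i j) (hA j k)
  have hinf : ∀ t ∈ Set.Icc (0 : ℝ) 1,
      (detPencil (q * r) (B * A) t).coeff (n * (q * r).natDegree) ≠ 0 := by
    intro t ht
    have h1 := h ⊤ le_top t ht
    rw [freqResp_top_of_fraction hq hA hPA, freqResp_top_of_fraction hr hB hCB] at h1
    have h2 := det_smul_one_add_ne_zero
      (Complex.ofReal_ne_zero.2 (Polynomial.leadingCoeff_ne_zero.2 hq.ne_zero))
      (Complex.ofReal_ne_zero.2 (Polynomial.leadingCoeff_ne_zero.2 hr.ne_zero)) h1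
    rw [coeff_detPencil le_rfl hBA]
    intro h0
    apply h2
    rw [← Complex.ofReal_zero, ← h0]
    refine Eq.trans ?_ (RingHom.map_det Complex.ofRealHom _).symm
    congr 1
    ext i k
    have hc : ∀ j, (B i j * A j k).coeff (r.natDegree + q.natDegree) =
        (B i j).coeff r.natDegree * (A j k).coeff q.natDegree := fun j =>
      Polynomial.coeff_mul_add_eq_of_natDegree_le (hB i j) (hA j k)
    have hqr : (q * r).coeff (r.natDegree + q.natDegree) = q.leadingCoeff * r.leadingCoeff := by
      rw [add_comm, Polynomial.coeff_mul_add_eq_of_natDegree_le le_rfl le_rfl]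
      rfl
    simp only [RingHom.mapMatrix_apply, Matrix.map_apply, Matrix.add_apply, Matrix.smul_apply,
      smul_eq_mul, hdeg, hqr, Matrix.mul_apply, Polynomial.finsetSum_coeff, hc, map_add, map_mul,
      map_sum, Complex.ofRealHom_eq_coe, Matrix.one_apply]
    split_ifs <;> simp
  have haxis : ∀ t ∈ Set.Icc (0 : ℝ) 1, ∀ ω : ℝ, 0 ≤ ω →
      Polynomial.aeval (Complex.I * ω) (detPencil (q * r) (B * A) t) ≠ 0 := by
    intro t ht ω hω
    have h1 := h ω (EReal.coe_nonneg.2 hω) t ht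
    rw [freqResp_of_fraction hq hPA, freqResp_of_fraction hr hCB] at h1
    have h2 := det_smul_one_add_ne_zero (hq _ (by simp)) (hr _ (by simp)) h1
    rw [aeval_detPencil, map_mul]
    convert h2 using 4
    exact Matrix.map_mul
  have hN := isHurwitz_detPencil (hq.mul hr) hBA haxis hinf
  -- Scaling `I + C P` by `q r` clears all denominators and multiplies the determinant by `(q r)^n`.
  have hdet : (1 + C * P).det =
      fraction (detPencil (q * r) (B * A) 1) ((q * r) ^ n) := by
    have hq0 := algebraMap_ne_zero_of_isHurwitz (hq.mul hr)
    rw [fraction, eq_div_iff (by rw [map_pow]; exact pow_ne_zero _ hq0), mul_comm, map_pow]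
    have := Matrix.det_smul (1 + C * P) (algebraMap (Polynomial ℝ) (RatFunc ℝ) (q * r))
    rw [Fintype.card_fin] at this
    rw [← this, detPencil, RingHom.map_det]
    congr 1
    ext1 i k
    have hCP : algebraMap (Polynomial ℝ) (RatFunc ℝ) (q * r) * (C * P) i k =
        algebraMap (Polynomial ℝ) (RatFunc ℝ) ((B * A) i k) := by
      rw [Matrix.mul_apply, Matrix.mul_apply, Finset.mul_sum, map_sum]
      refine Finset.sum_congr rfl fun j _ => ?_
      have h1 := algebraMap_ne_zero_of_isHurwitz hq
      have h2 := algebraMap_ne_zero_of_isHurwitz hr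
      rw [hCB, hPA, map_mul, map_mul]
      field_simp
    simp only [RingHom.mapMatrix_apply, Matrix.map_apply, Matrix.add_apply, Matrix.smul_apply,
      smul_eq_mul, mul_add, map_add, map_mul, map_one, one_mul] at hCP ⊢
    rw [hCP, Matrix.one_apply, Matrix.one_apply]
    split_ifs <;> simp
  rw [hdet]
  refine ⟨div_ne_zero (algebraMap_ne_zero_of_isHurwitz hN)
    (algebraMap_ne_zero_of_isHurwitz ((hq.mul hr).pow n)), ?_⟩
  rw [fraction, inv_div]
  refine isStableFun_fraction hN ?_
  rw [Polynomial.natDegree_pow]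
  -- Nonsingularity at infinity makes the inverse determinant proper.
  exact Polynomial.le_natDegree_of_ne_zero (hinf 1 (Set.right_mem_Icc.2 zero_le_one))

theorem isFeedbackStable_of_det_ne_zero {n : ℕ} {P C : Matrix (Fin n) (Fin n) (RatFunc ℝ)}
    (hP : IsStable P) (hC : IsStable C)
    (h : ∀ ω : EReal, 0 ≤ ω → ∀ t ∈ Set.Icc (0 : ℝ) 1,
      (1 + (t : ℂ) • (freqResp C ω * freqResp P ω)).det ≠ 0) :
    IsFeedbackStable P C := by
  obtain ⟨hdet, hinv⟩ := isStableFun_inv_det hP hC h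
  have hL : IsStable (1 + C * P) := fun i k =>
    (isStable_one i k).add (hC.mul hP i k)
  have hrows : IsStable (Matrix.fromRows (1 : Matrix (Fin n) (Fin n) (RatFunc ℝ)) P) := by
    rintro (i | i) k
    exacts [isStable_one i k, hP i k]
  have hcols : IsStable (Matrix.fromCols (1 : Matrix (Fin n) (Fin n) (RatFunc ℝ)) C) := by
    rintro i (k | k)
    exacts [isStable_one i k, hC i k]
  exact ⟨isUnit_iff_ne_zero.2 hdet, (hrows.mul (hL.inv hinv)).mul hcols⟩

end MixedGainPhase

theorem mainTheorem7 (n : ℕ) (P C : Matrix (Fin n) (Fin n) (RatFunc ℝ))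
    (hP : MixedGainPhase.IsStable P) (hC : MixedGainPhase.IsStable C)
    (hCsec : MixedGainPhase.IsFreqwiseSectorial C)
    (hθ : ∀ ω : EReal, 0 ≤ ω → ∃ θ : ℝ, θ ∈ Set.Ico 0 Real.pi ∧
      MixedGainPhase.constrainedGain θ (MixedGainPhase.freqResp P ω) *
        MixedGainPhase.sigmaMax (MixedGainPhase.freqResp C ω) < 1 ∧
      MixedGainPhase.phaseSector (MixedGainPhase.freqResp C ω) ⊆
        Set.Ioo (-Real.pi + θ) (Real.pi - θ)) :
    MixedGainPhase.IsFeedbackStable P C := by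
  refine MixedGainPhase.isFeedbackStable_of_det_ne_zero hP hC fun ω hω t ht => ?_
  obtain ⟨θ, hθI, hgain, hphase⟩ := hθ ω hω
  exact MixedGainPhase.det_one_add_smul_mul_ne_zero (hCsec ω) hθI.1 hgain hphase ht
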